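/- Let $\mathcal{H}_A,\mathcal{H}_B$ be separable complex Hilbert spaces and let $G$ be a positive semidefinite self-adjoint (possibly unbounded, densely defined) operator on $\mathcal{H}_A$ with positive square root $\sqrt G$. For a Hilbert space $\mathcal{K}$, a linear operator $V$ from $\mathcal{H}_A$ to $\mathcal{K}$ is called $\sqrt G$-bounded if its domain contains $\mathcal{D}(\sqrt G)$ and, for some $a,b\ge 0$, $$\|V\varphi\|^2\le a^2\|\varphi\|^2+b^2\|\sqrt G\varphi\|^2\qquad\text{for all }\varphi\in\mathcal{D}(\sqrt G);$$ it is called $\sqrt G$-infinitesimal if moreover the infimum of the numbers $b\ge0$ for which this holds with some $a\ge 0$ equals $0$. Let $\mathfrak{S}_G$ be the set of states $\rho$ on $\mathcal{H}_A$ (positive operators of trace one) with finite energy $\mathrm{Tr}\,G\rho<+\infty$, let $\mathfrak{T}_G$ be its linear span, and let $\mathfrak{T}(\mathcal{H}_B)$ be the space of trace class operators on $\mathcal{H}_B$. Given a linear map $\Phi:\mathfrak{T}_G\to\mathfrak{T}(\mathcal{H}_B)$, a representing operator of $\Phi$ is a $\sqrt G$-bounded operator $V$ from $\mathcal{H}_A$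 to $\mathcal{H}_B\otimes\mathcal{H}_E$, where $\mathcal{H}_E$ is some separable Hilbert space, such that $$\Phi(\rho)=\mathrm{Tr}_E\,V\rho V^*\qquad\text{for all }\rho\in\mathfrak{S}_G,$$ where $V\rho V^*:=\sum_i|V\varphi_i\rangle\langle V\varphi_i|$ for any decomposition $\rho=\sum_i|\varphi_i\rangle\langle\varphi_i|$ and $\mathrm{Tr}_E$ is the partial trace over $\mathcal{H}_E$. Let $\mathfrak{F}_G^0(A,B)$ be the cone of all linear maps $\Phi:\mathfrak{T}_G\to\mathfrak{T}(\mathcal{H}_B)$ that have at least one $\sqrt G$-infinitesimal representing operator (for some separable $\mathcal{H}_E$). If $\Phi\in\mathfrak{F}_G^0(A,B)$, then every representing operator $V$ of $\Phi$, with values in $\mathcal{H}_B\otimes\mathcal{H}_E$ for any separable Hilbert space $\mathcal{H}_E$, is $\sqrt G$-infinitesimal. -/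

import Mathlib

open scoped InnerProductSpace TensorProduct ENNReal ComplexOrder
open InnerProductSpace

universe uA uB uE uF

/-! ## Unbounded positive operators and their square roots -/

section SquareRoot

variable {H : Type*} [NormedAddCommGroup H] [InnerProductSpace ℂ H] [CompleteSpace H]

/-- An unbounded operator on a Hilbert space that is self-adjoint (in particular densely defined)
and positive semidefinite. -/
structure IsPositiveSelfAdjoint (G : H →ₗ.[ℂ] H) : Prop where
  selfAdjoint : IsSelfAdjoint G
  nonneg : ∀ x : G.domain, 0 ≤ (⟪G x, (x : H)⟫_ℂ).re

/-- `S` is the positive square root of `G`: it is positive and self-adjoint and `G = S ∘ S`,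
the domain of `S ∘ S` being the natural one. -/
structure IsPositiveSqrt (G S : H →ₗ.[ℂ] H) : Prop where
  positive : IsPositiveSelfAdjoint S
  sq : ∀ x y : H, (x, y) ∈ G.graph ↔ ∃ z : H, (x, z) ∈ S.graph ∧ (z, y) ∈ S.graph

theorem IsPositiveSelfAdjoint.inner_comm {G : H →ₗ.[ℂ] H} (hG : IsPositiveSelfAdjoint G)
    (x y : G.domain) : ⟪G x, (y : H)⟫_ℂ = ⟪(x : H), G y⟫_ℂ := by
  have h := LinearPMap.adjoint_isFormalAdjoint (T := G) hG.selfAdjoint.dense_domain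
  rw [LinearPMap.isSelfAdjoint_def.1 hG.selfAdjoint] at h
  exact h x y

theorem IsPositiveSelfAdjoint.mem_graph {G : H →ₗ.[ℂ] H} (hG : IsPositiveSelfAdjoint G)
    {y z : H} (h : ∀ x : G.domain, ⟪z, (x : H)⟫_ℂ = ⟪y, G x⟫_ℂ) : (y, z) ∈ G.graph := by
  have hd := hG.selfAdjoint.dense_domain
  have hs := LinearPMap.isSelfAdjoint_def.1 hG.selfAdjoint
  have hy : y ∈ G.adjoint.domain := LinearPMap.mem_adjoint_domain_of_exists y ⟨z, h⟩
  have hv : G.adjoint ⟨y, hy⟩ = z := LinearPMap.adjoint_apply_eq hd ⟨y, hy⟩ h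
  have : (y, z) ∈ G.adjoint.graph := by
    rw [← hv]; exact LinearPMap.mem_graph _ ⟨y, hy⟩
  rwa [hs] at this

/-- The resolvent `(1 + G)⁻¹`. -/
theorem IsPositiveSelfAdjoint.exists_resolvent {G : H →ₗ.[ℂ] H} (hG : IsPositiveSelfAdjoint G) :
    ∃ R : H →L[ℂ] H, 0 ≤ R ∧ R ≤ 1 ∧ (∀ w, (R w, w - R w) ∈ G.graph) ∧
      ∀ x : G.domain, R ((x : H) + G x) = x := by
  have key : ∀ x : G.domain, ‖(x : H)‖ ^ 2 + ‖G x‖ ^ 2 ≤ ‖(x : H) + G x‖ ^ 2 := by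
    intro x
    have h1 := hG.nonneg x
    rw [norm_add_sq (𝕜 := ℂ), ← inner_conj_symm]
    simp only [RCLike.re_to_complex, Complex.conj_re]
    linarith
  have b1 : ∀ x : G.domain, ‖(x : H)‖ ≤ ‖(x : H) + G x‖ := fun x =>
    abs_le_of_sq_le_sq' (by nlinarith [key x, sq_nonneg ‖G x‖]) (norm_nonneg _) |>.2
  have b2 : ∀ x : G.domain, ‖G x‖ ≤ ‖(x : H) + G x‖ := fun x =>
    abs_le_of_sq_le_sq' (by nlinarith [key x, sq_nonneg ‖(x : H)‖]) (norm_nonneg _) |>.2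
  have hcl : IsClosed (G.graph : Set (H × H)) := hG.selfAdjoint.isClosed
  have : CompleteSpace G.graph := hcl.completeSpace_coe
  let A : G.graph →L[ℂ] H :=
    (ContinuousLinearMap.fst ℂ H H + ContinuousLinearMap.snd ℂ H H).comp G.graph.subtypeL
  have hA : AntilipschitzWith 1 A := by
    refine ContinuousLinearMap.antilipschitz_of_bound A ?_
    rintro ⟨⟨p, q⟩, hp⟩
    obtain ⟨x, hx1, hx2⟩ := (LinearPMap.mem_graph_iff G).1 hp
    simp only at hx1 hx2
    subst hx1 hx2
    simp only [A, NNReal.coe_one, one_mul]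
    exact max_le (b1 x) (b2 x)
  have hrc : IsClosed (A.range : Set H) := by
    exact hA.isClosed_range A.uniformContinuous
  have : CompleteSpace A.range := hrc.completeSpace_coe
  have htop : A.range = ⊤ := by
    rw [← Submodule.orthogonal_eq_bot_iff, Submodule.eq_bot_iff]
    intro y hy
    have h0 : ∀ x : G.domain, ⟪(x : H) + G x, y⟫_ℂ = 0 := by
      intro x
      exact (Submodule.mem_orthogonal _ _).1 hy _ ⟨⟨_, LinearPMap.mem_graph G x⟩, rfl⟩
    have hg : (y, -y) ∈ G.graph := by
      refine hG.mem_graph fun x => ?_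
      have h1 := h0 x
      rw [inner_add_left] at h1
      have h2 := congrArg (starRingEnd ℂ) h1
      simp only [map_add, inner_conj_symm, map_zero] at h2
      rw [inner_neg_left]
      linear_combination -h2
    obtain ⟨x, hx1, hx2⟩ := (LinearPMap.mem_graph_iff G).1 hg
    simp only at hx1 hx2
    have h3 := b1 x
    rw [hx1, hx2] at h3
    simpa using h3
  choose p hp using fun w => (LinearMap.range_eq_top.1 htop w)
  have hinj : Function.Injective A := hA.injective
  let R₀ : H →ₗ[ℂ] H :=
    { toFun := fun w => (p w : H × H).1
      map_add' := fun v w => by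
        have : p (v + w) = p v + p w := hinj (by
          have h1 := hp (v + w); have h2 := hp v; have h3 := hp w
          simp only [ContinuousLinearMap.coe_coe] at h1 h2 h3
          rw [map_add, h1, h2, h3])
        rw [this]; rfl
      map_smul' := fun c w => by
        have : p (c • w) = c • p w := hinj (by
          have h1 := hp (c • w); have h2 := hp w
          simp only [ContinuousLinearMap.coe_coe] at h1 h2
          rw [map_smul, h1, h2])
        rw [this]; rfl }
  have hgr : ∀ w, (R₀ w, w - R₀ w) ∈ G.graph := by
    intro w
    have h1 : (p w : H × H).1 + (p w : H × H).2 = w := hp w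
    have h2 : ((p w : H × H).1, w - (p w : H × H).1) = (p w : H × H) :=
      Prod.ext rfl (by rw [sub_eq_iff_eq_add', h1])
    change ((p w : H × H).1, w - (p w : H × H).1) ∈ G.graph
    rw [h2]; exact (p w).2
  have hgr' : ∀ w, ∃ x : G.domain, (x : H) = R₀ w ∧ G x = w - R₀ w := fun w =>
    (LinearPMap.mem_graph_iff G).1 (hgr w)
  have hbd : ∀ w, ‖R₀ w‖ ≤ 1 * ‖w‖ := by
    intro w
    obtain ⟨x, hx1, hx2⟩ := hgr' w
    have := b1 x
    rw [hx2, hx1] at this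
    simpa using this
  let R : H →L[ℂ] H := R₀.mkContinuous 1 hbd
  have hsym : ∀ v w, ⟪R₀ v, w⟫_ℂ = ⟪v, R₀ w⟫_ℂ := by
    intro v w
    obtain ⟨x, hx1, hx2⟩ := hgr' v
    obtain ⟨y, hy1, hy2⟩ := hgr' w
    have h := hG.inner_comm x y
    rw [hx1, hx2, hy1, hy2, inner_sub_left, inner_sub_right] at h
    linear_combination -h
  have hposG : ∀ w, 0 ≤ (⟪w - R₀ w, R₀ w⟫_ℂ).re := by
    intro w
    obtain ⟨x, hx1, hx2⟩ := hgr' w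
    have := hG.nonneg x
    rwa [hx1, hx2] at this
  refine ⟨R, ?_, ?_, hgr, ?_⟩
  · rw [ContinuousLinearMap.nonneg_iff_isPositive]
    refine ⟨fun v w => hsym v w, fun w => ?_⟩
    have h := hposG w
    rw [inner_sub_left, Complex.sub_re] at h
    have h2 : 0 ≤ (⟪R₀ w, R₀ w⟫_ℂ).re := inner_self_nonneg (𝕜 := ℂ)
    have h3 : ⟪R₀ w, w⟫_ℂ = ⟪w, R₀ w⟫_ℂ := hsym w w
    change 0 ≤ (⟪R₀ w, w⟫_ℂ).re
    rw [h3]; linarith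
  · rw [ContinuousLinearMap.le_def]
    refine ⟨fun v w => ?_, fun w => ?_⟩
    · change ⟪v - R₀ v, w⟫_ℂ = ⟪v, w - R₀ w⟫_ℂ
      rw [inner_sub_left, inner_sub_right, hsym]
    · change 0 ≤ (⟪w - R₀ w, w⟫_ℂ).re
      have h := hposG w
      have h2 : 0 ≤ (⟪w - R₀ w, w - R₀ w⟫_ℂ).re := inner_self_nonneg (𝕜 := ℂ)
      rw [inner_sub_right, Complex.sub_re] at h2
      linarith
  · intro x
    obtain ⟨y, hy1, hy2⟩ := hgr' ((x : H) + G x)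
    have h := b1 (y - x)
    have h4 : ((y - x : G.domain) : H) + G (y - x) = 0 := by
      rw [LinearPMap.map_sub, hy2, Submodule.coe_sub, hy1]; abel
    rw [h4, norm_zero] at h
    have h5 := norm_le_zero_iff.1 h
    rw [Submodule.coe_sub, sub_eq_zero] at h5
    change R₀ ((x : H) + G x) = x
    rw [← hy1, h5]

/-- Every positive self-adjoint operator has a positive square root. -/
theorem IsPositiveSelfAdjoint.exists_sqrt {G : H →ₗ.[ℂ] H} (hG : IsPositiveSelfAdjoint G) :
    ∃ S : H →ₗ.[ℂ] H, IsPositiveSqrt G S := by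
  obtain ⟨R, hR0, hR1, hgr, hinv⟩ := hG.exists_resolvent
  have hRinj : ∀ w, R w = 0 → w = 0 := by
    intro w hw
    obtain ⟨x, hx1, hx2⟩ := (LinearPMap.mem_graph_iff G).1 (hgr w)
    simp only [hw, sub_zero] at hx1 hx2
    have : x = 0 := Subtype.ext hx1
    rw [← hx2, this, LinearPMap.map_zero]
  obtain ⟨T, C, hT, hC, hTT, hCC, hTC⟩ : ∃ T C : H →L[ℂ] H, 0 ≤ T ∧ 0 ≤ C ∧ T * T = R ∧
      C * C = 1 - R ∧ Commute T C := by
    refine ⟨CFC.sqrt R, CFC.sqrt (1 - R), CFC.sqrt_nonneg _, CFC.sqrt_nonneg _,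
      CFC.sqrt_mul_sqrt_self R hR0, CFC.sqrt_mul_sqrt_self _ (sub_nonneg.2 hR1), ?_⟩
    have h1 : Commute R (CFC.sqrt R) := by
      have h := CFC.sqrt_mul_sqrt_self R hR0
      generalize CFC.sqrt R = T at h
      rw [← h]; exact (Commute.refl T).mul_left (Commute.refl T)
    have h2 : Commute (1 - R) (CFC.sqrt R) := (Commute.one_left _).sub_left h1
    exact (Commute.cfcₙ_nnreal h2 NNReal.sqrt).symm
  have hTTx : ∀ x, T (T x) = R x := fun x => by rw [← hTT]; rfl
  have hCCx : ∀ x, C (C x) = x - R x := fun x => by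
    have := congrArg (fun f : H →L[ℂ] H => f x) hCC; exact this
  have hTCx : ∀ x, T (C x) = C (T x) := fun x =>
    congrArg (fun f : H →L[ℂ] H => f x) hTC.eq
  have hTinj : Function.Injective T := by
    rw [injective_iff_map_eq_zero]
    intro w hw
    exact hRinj w (by rw [← hTTx, hw, map_zero])
  have hTs : ∀ x y, ⟪T x, y⟫_ℂ = ⟪x, T y⟫_ℂ := fun x y =>
    ((ContinuousLinearMap.nonneg_iff_isPositive T).1 hT).inner_left_eq_inner_right x y
  have hCs : ∀ x y, ⟪C x, y⟫_ℂ = ⟪x, C y⟫_ℂ := fun x y =>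
    ((ContinuousLinearMap.nonneg_iff_isPositive C).1 hC).inner_left_eq_inner_right x y
  let e : H ≃ₗ[ℂ] T.range := LinearEquiv.ofInjective (T : H →ₗ[ℂ] H) hTinj
  let S : H →ₗ.[ℂ] H := ⟨T.range, (C : H →ₗ[ℂ] H).comp e.symm.toLinearMap⟩
  have hSe : ∀ u, S (e u) = C u := fun u => by
    change C (e.symm (e u)) = C u
    rw [e.symm_apply_apply]
  have hes : ∀ x : S.domain, ∃ u, e u = x := fun x => ⟨e.symm x, e.apply_symm_apply x⟩
  have heT : ∀ u, ((e u : T.range) : H) = T u := fun u => rfl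
  have hSg : ∀ x y, (x, y) ∈ S.graph ↔ ∃ u, T u = x ∧ C u = y := by
    intro x y
    rw [LinearPMap.mem_graph_iff]
    constructor
    · rintro ⟨z, hz1, hz2⟩
      obtain ⟨u, rfl⟩ := hes z
      exact ⟨u, hz1, (hSe u).symm.trans hz2⟩
    · rintro ⟨u, hu1, hu2⟩
      exact ⟨e u, hu1, (hSe u).trans hu2⟩
  have hdense : Dense (S.domain : Set H) := by
    change Dense (T.range : Set H)
    rw [Submodule.dense_iff_topologicalClosure_eq_top,
      Submodule.topologicalClosure_eq_top_iff, Submodule.eq_bot_iff]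
    intro y hy
    apply hTinj
    rw [map_zero, ← inner_self_eq_zero (𝕜 := ℂ), hTs, ← inner_conj_symm,
      (Submodule.mem_orthogonal _ _).1 hy (T (T y)) ⟨T y, rfl⟩, map_zero]
  have hSsym : S.IsFormalAdjoint S := by
    intro x y
    obtain ⟨u, rfl⟩ := hes x
    obtain ⟨v, rfl⟩ := hes y
    rw [hSe, hSe, heT, heT, hCs, hTs, hTCx]
  have hSsa : IsSelfAdjoint S := by
    rw [LinearPMap.isSelfAdjoint_def]
    refine le_antisymm ?_ (hSsym.le_adjoint hdense)
    refine LinearPMap.le_of_le_graph ?_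
    rintro ⟨y, z⟩ hyz
    obtain ⟨y', hy1, hy2⟩ := (LinearPMap.mem_graph_iff _).1 hyz
    simp only at hy1 hy2
    have hf := LinearPMap.adjoint_isFormalAdjoint hdense y'
    have h1 : C y = T z := by
      refine ext_inner_right ℂ fun u => ?_
      have := hf (e u)
      rw [hSe, heT, hy1, hy2] at this
      rw [hCs, hTs, this]
    rw [hSg]
    refine ⟨T y + C z, ?_, ?_⟩
    · rw [map_add, hTTx, hTCx, ← h1, hCCx]; abel
    · rw [map_add, hCCx, ← hTCx, h1, hTTx]; abel
  refine ⟨S, ⟨hSsa, fun x => ?_⟩, fun x y => ?_⟩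
  · obtain ⟨u, rfl⟩ := hes x
    rw [hSe, heT, ← hTs]
    exact ((ContinuousLinearMap.nonneg_iff_isPositive _).1 (hTC.mul_nonneg hT hC)).2 u
  · constructor
    · intro h
      obtain ⟨x', hx1, hx2⟩ := (LinearPMap.mem_graph_iff G).1 h
      simp only at hx1 hx2
      have h3 := hinv x'
      rw [hx1, hx2] at h3
      refine ⟨C (T (x + y)), (hSg _ _).2 ⟨T (x + y), by rw [hTTx, h3], rfl⟩,
        (hSg _ _).2 ⟨C (x + y), hTCx _, ?_⟩⟩
      rw [hCCx, h3]; abel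
    · rintro ⟨z, h1, h2⟩
      obtain ⟨u, hu1, hu2⟩ := (hSg _ _).1 h1
      obtain ⟨v, hv1, hv2⟩ := (hSg _ _).1 h2
      have h3 : u = T (T u + C v) := by
        rw [map_add, hTTx, hTCx, hv1, ← hu2, hCCx]; abel
      have h4 : x = R (T u + C v) := by rw [← hTTx, ← h3, hu1]
      have h5 : y = (T u + C v) - x := by
        rw [hu1, hv2]; abel
      rw [h5, h4]
      exact hgr _

/-- The positive square root `√G` of a positive self-adjoint operator `G`. -/
noncomputable def posSqrt (G : H →ₗ.[ℂ] H) (hG : IsPositiveSelfAdjoint G) : H →ₗ.[ℂ] H :=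
  Classical.choose hG.exists_sqrt

theorem posSqrt_spec (G : H →ₗ.[ℂ] H) (hG : IsPositiveSelfAdjoint G) :
    IsPositiveSqrt G (posSqrt G hG) :=
  Classical.choose_spec hG.exists_sqrt

end SquareRoot

/-! ## Relatively bounded and infinitesimal operators -/

section RelativelyBounded

variable {H K : Type*} [NormedAddCommGroup H] [InnerProductSpace ℂ H]
  [NormedAddCommGroup K] [InnerProductSpace ℂ K]

/-- `‖A x‖² ≤ a² ‖x‖² + b² ‖S x‖²` for all `x` in the domain of `S` (used when the domain of `A`
contains that of `S`). -/
def RelBoundedBy (S : H →ₗ.[ℂ] H) (A : H →ₗ.[ℂ] K) (a b : ℝ) : Prop :=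
  ∀ (x : H) (hS : x ∈ S.domain) (hA : x ∈ A.domain),
    ‖A ⟨x, hA⟩‖ ^ 2 ≤ a ^ 2 * ‖x‖ ^ 2 + b ^ 2 * ‖S ⟨x, hS⟩‖ ^ 2

/-- `A` is relatively bounded with respect to `S` (briefly, `S`-bounded). -/
def IsRelBounded (S : H →ₗ.[ℂ] H) (A : H →ₗ.[ℂ] K) : Prop :=
  S.domain ≤ A.domain ∧ ∃ a b : ℝ, 0 ≤ a ∧ 0 ≤ b ∧ RelBoundedBy S A a b

/-- The `S`-bound of an `S`-bounded operator `A`. -/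
noncomputable def relBound (S : H →ₗ.[ℂ] H) (A : H →ₗ.[ℂ] K) : ℝ :=
  sInf {b : ℝ | 0 ≤ b ∧ ∃ a : ℝ, 0 ≤ a ∧ RelBoundedBy S A a b}

/-- `A` is `S`-infinitesimal: it is `S`-bounded with `S`-bound equal to zero. -/
def IsInfinitesimal (S : H →ₗ.[ℂ] H) (A : H →ₗ.[ℂ] K) : Prop :=
  IsRelBounded S A ∧ relBound S A = 0

end RelativelyBounded

/-! ## Trace class operators, traces and partial traces -/

section TraceClass

/-- An index set for a Hilbert basis of `H`. -/
def stdBasisIndex (H : Type*) [NormedAddCommGroup H] [InnerProductSpace ℂ H] [CompleteSpace H] :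
    Set H :=
  Classical.choose (exists_hilbertBasis ℂ H)

/-- A Hilbert (complete orthonormal) basis of `H`. The traces below do not depend on its choice. -/
noncomputable def stdBasis (H : Type*) [NormedAddCommGroup H] [InnerProductSpace ℂ H]
    [CompleteSpace H] : HilbertBasis (stdBasisIndex H) ℂ H :=
  Classical.choose (Classical.choose_spec (exists_hilbertBasis ℂ H))

/-- The space of trace class operators on `H`: the operators `T = ∑ₙ |aₙ⟩⟨bₙ|` with
`∑ₙ ‖aₙ‖ ‖bₙ‖ < ∞`. -/
def traceClass (H : Type*) [NormedAddCommGroup H] [InnerProductSpace ℂ H] :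
    Submodule ℂ (H →L[ℂ] H) where
  carrier := {T | ∃ a b : ℕ → H, Summable (fun n => ‖a n‖ * ‖b n‖) ∧
    HasSum (fun n => rankOne ℂ (a n) (b n)) T}
  zero_mem' := ⟨0, 0, by simp, by simp⟩
  add_mem' := by
    rintro T U ⟨a, b, h1, h2⟩ ⟨c, d, h3, h4⟩
    let e : ℕ ≃ ℕ ⊕ ℕ := Equiv.natSumNatEquivNat.symm
    refine ⟨Sum.elim a c ∘ e, Sum.elim b d ∘ e, ?_, ?_⟩
    · refine (e.summable_iff (f := fun s => ‖Sum.elim a c s‖ * ‖Sum.elim b d s‖)).2 ?_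
      exact (HasSum.sum (f := fun s => ‖Sum.elim a c s‖ * ‖Sum.elim b d s‖)
        h1.hasSum h3.hasSum).summable
    · refine (e.hasSum_iff
        (f := fun s => rankOne ℂ (Sum.elim a c s) (Sum.elim b d s))).2 ?_
      exact HasSum.sum (f := fun s => rankOne ℂ (Sum.elim a c s) (Sum.elim b d s)) h2 h4
  smul_mem' := by
    rintro z T ⟨a, b, h1, h2⟩
    refine ⟨fun n => z • a n, b, ?_, ?_⟩
    · simpa [norm_smul, mul_assoc] using h1.mul_left ‖z‖
    · simpa using h2.const_smul z

/-- The trace of a trace class operator. -/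
noncomputable def opTrace {H : Type*} [NormedAddCommGroup H] [InnerProductSpace ℂ H]
    [CompleteSpace H] (T : H →L[ℂ] H) : ℂ :=
  ∑' i, ⟪stdBasis H i, T (stdBasis H i)⟫_ℂ

/-- The Hilbert space tensor product: the completion of the algebraic one. -/
abbrev HilbertTensor (H K : Type*) [NormedAddCommGroup H] [InnerProductSpace ℂ H]
    [NormedAddCommGroup K] [InnerProductSpace ℂ K] : Type _ :=
  UniformSpace.Completion (H ⊗[ℂ] K)

/-- The bounded operator `x ↦ x ⊗ f` from `H` to the Hilbert tensor product of `H` and `K`. -/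
noncomputable def tensorRight (H : Type*) {K : Type*} [NormedAddCommGroup H]
    [InnerProductSpace ℂ H] [NormedAddCommGroup K] [InnerProductSpace ℂ K] (f : K) :
    H →L[ℂ] HilbertTensor H K :=
  (UniformSpace.Completion.toComplL (𝕜 := ℂ) (E := H ⊗[ℂ] K)).comp
    ((TensorProduct.mkL ℂ H K).flip f)

/-- The partial trace over `K` of a trace class operator `T` on `H ⊗ K`: with `Jₖ x = x ⊗ fₖ` for
a Hilbert basis `f` of `K`, it is the sum `∑ₖ Jₖ* T Jₖ`, which converges in trace norm. -/
noncomputable def partialTrace {H K : Type*} [NormedAddCommGroup H] [InnerProductSpace ℂ H]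
    [CompleteSpace H] [NormedAddCommGroup K] [InnerProductSpace ℂ K] [CompleteSpace K]
    (T : HilbertTensor H K →L[ℂ] HilbertTensor H K) : H →L[ℂ] H :=
  ∑' k, (ContinuousLinearMap.adjoint (tensorRight H (stdBasis K k))).comp
    (T.comp (tensorRight H (stdBasis K k)))

end TraceClass

/-! ## States of finite energy and Stinespring-like representations -/

section Cone

/-- States (density operators): positive trace class operators with unit trace. -/
def IsState {H : Type*} [NormedAddCommGroup H] [InnerProductSpace ℂ H] [CompleteSpace H]
    (ρ : H →L[ℂ] H) : Prop :=
  ρ.IsPositive ∧ ρ ∈ traceClass H ∧ opTrace ρ = 1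

open Classical in
/-- The quadratic form `‖√G x‖²` of `G`, equal to `∞` outside the domain of `√G`. -/
noncomputable def energyForm {H : Type*} [NormedAddCommGroup H] [InnerProductSpace ℂ H]
    [CompleteSpace H] (G : H →ₗ.[ℂ] H) (hG : IsPositiveSelfAdjoint G) (x : H) : ℝ≥0∞ :=
  if h : x ∈ (posSqrt G hG).domain then ‖posSqrt G hG ⟨x, h⟩‖ₑ ^ 2 else ∞

/-- The energy `Tr Gρ ∈ [0, ∞]` of a positive operator `ρ`, that is `∑ᵢ ‖√G √ρ eᵢ‖²` for a Hilbert
basis `e`. -/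
noncomputable def energy {H : Type*} [NormedAddCommGroup H] [InnerProductSpace ℂ H]
    [CompleteSpace H] (G : H →ₗ.[ℂ] H) (hG : IsPositiveSelfAdjoint G) (ρ : H →L[ℂ] H) : ℝ≥0∞ :=
  ∑' i, energyForm G hG (CFC.sqrt ρ (stdBasis H i))

/-- The set of states with finite energy. -/
def finiteEnergyStates {H : Type*} [NormedAddCommGroup H] [InnerProductSpace ℂ H]
    [CompleteSpace H] (G : H →ₗ.[ℂ] H) (hG : IsPositiveSelfAdjoint G) : Set (H →L[ℂ] H) :=
  {ρ | IsState ρ ∧ energy G hG ρ < ∞}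

/-- The linear span of the states with finite energy. -/
def finiteEnergySpan {H : Type*} [NormedAddCommGroup H] [InnerProductSpace ℂ H]
    [CompleteSpace H] (G : H →ₗ.[ℂ] H) (hG : IsPositiveSelfAdjoint G) :
    Submodule ℂ (H →L[ℂ] H) :=
  Submodule.span ℂ (finiteEnergyStates G hG)

/-- `T = V ρ V*` in the sense that `T = ∑ᵢ |V φᵢ⟩⟨V φᵢ|` for any decomposition
`ρ = ∑ᵢ |φᵢ⟩⟨φᵢ|`. (If `ρ` has finite energy and `V` is `√G`-bounded, then the vectors of any
decomposition of `ρ` lie in the domain of `√G`, hence in that of `V`.) -/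
def IsSandwich {H K : Type*} [NormedAddCommGroup H] [InnerProductSpace ℂ H] [CompleteSpace H]
    [NormedAddCommGroup K] [InnerProductSpace ℂ K] [CompleteSpace K]
    (V : H →ₗ.[ℂ] K) (ρ : H →L[ℂ] H) (T : K →L[ℂ] K) : Prop :=
  ∀ φ : ℕ → V.domain, HasSum (fun i => rankOne ℂ (φ i : H) (φ i : H)) ρ →
    HasSum (fun i => rankOne ℂ (V (φ i)) (V (φ i))) T

/-- `V` is a representing operator of the linear map `Φ`: it is a `√G`-bounded operator from `HA`
to `HB ⊗ HE` and `Φ(ρ) = Tr_E V ρ V*` for all states `ρ` with finite energy. -/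
def IsRepresenting {HA HB HE : Type*}
    [NormedAddCommGroup HA] [InnerProductSpace ℂ HA] [CompleteSpace HA]
    [NormedAddCommGroup HB] [InnerProductSpace ℂ HB] [CompleteSpace HB]
    [NormedAddCommGroup HE] [InnerProductSpace ℂ HE] [CompleteSpace HE]
    (G : HA →ₗ.[ℂ] HA) (hG : IsPositiveSelfAdjoint G)
    (Φ : finiteEnergySpan G hG →ₗ[ℂ] traceClass HB) (V : HA →ₗ.[ℂ] HilbertTensor HB HE) : Prop :=
  IsRelBounded (posSqrt G hG) V ∧
    ∀ (ρ : HA →L[ℂ] HA) (hρ : ρ ∈ finiteEnergyStates G hG),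
      ∃ T : HilbertTensor HB HE →L[ℂ] HilbertTensor HB HE, IsSandwich V ρ T ∧
        (Φ ⟨ρ, Submodule.subset_span hρ⟩ : HB →L[ℂ] HB) = partialTrace T

/-- The cone of linear maps, from the span of the finite energy states on `HA` to the trace class
operators on `HB`, that have some `√G`-infinitesimal representing operator with values in
`HB ⊗ HE`, for some separable Hilbert space `HE`. -/
def infinitesimalCone.{vE, vA, vB} {HA : Type vA} (HB : Type vB)
    [NormedAddCommGroup HA] [InnerProductSpace ℂ HA] [CompleteSpace HA]
    [NormedAddCommGroup HB] [InnerProductSpace ℂ HB] [CompleteSpace HB]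
    (G : HA →ₗ.[ℂ] HA) (hG : IsPositiveSelfAdjoint G) :
    Set (finiteEnergySpan G hG →ₗ[ℂ] traceClass HB) :=
  {Φ | ∃ (HE : Type vE) (_ : NormedAddCommGroup HE) (_ : InnerProductSpace ℂ HE)
    (_ : CompleteSpace HE) (_ : TopologicalSpace.SeparableSpace HE)
    (V : HA →ₗ.[ℂ] HilbertTensor HB HE),
      IsRepresenting G hG Φ V ∧ IsInfinitesimal (posSqrt G hG) V}

end Cone

/-!
For a unit vector `x` in the domain of `√G` the projection `|x⟩⟨x|` is a state of finite energy, and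
`V |x⟩⟨x| V* = |V x⟩⟨V x|`. The partial trace preserves traces, so every representing operator `V`
of `Φ` satisfies `‖V x‖² = Tr Φ(|x⟩⟨x|)`. By homogeneity `Φ` determines `‖V x‖` on the whole domain
of `√G`, and the `√G`-bound of `V` depends on nothing else.
-/

theorem norm_apply_eq_of_forall_norm_eq_one {𝕜 E F F' : Type*} [RCLike 𝕜]
    [NormedAddCommGroup E] [NormedSpace 𝕜 E] [SeminormedAddCommGroup F] [NormedSpace 𝕜 F]
    [SeminormedAddCommGroup F'] [NormedSpace 𝕜 F'] {f : E →ₗ[𝕜] F} {g : E →ₗ[𝕜] F'}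
    (h : ∀ x, ‖x‖ = 1 → ‖f x‖ = ‖g x‖) (x : E) : ‖f x‖ = ‖g x‖ := by
  obtain rfl | hx := eq_or_ne x 0
  · rw [map_zero, map_zero, norm_zero, norm_zero]
  · simpa [norm_smul, hx] using h ((‖x‖⁻¹ : 𝕜) • x) (norm_smul_inv_norm hx)

theorem continuousLinearMap_ext_on₂ {𝕜 E F G : Type*} [NontriviallyNormedField 𝕜]
    [SeminormedAddCommGroup E] [NormedSpace 𝕜 E] [SeminormedAddCommGroup F] [NormedSpace 𝕜 F]
    [NormedAddCommGroup G] [NormedSpace 𝕜 G] {s : Set E} {t : Set F}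
    (hs : Dense (Submodule.span 𝕜 s : Set E)) (ht : Dense (Submodule.span 𝕜 t : Set F))
    {f g : E →L[𝕜] F →L[𝕜] G} (h : ∀ x ∈ s, ∀ y ∈ t, f x y = g x y) : f = g :=
  ContinuousLinearMap.ext_on hs fun x hx => ContinuousLinearMap.ext_on ht (h x hx)

theorem hasSum_apply_piSingle {ι α M : Type*} [DecidableEq ι] [Zero α] [AddCommMonoid M]
    [TopologicalSpace M] {f : α → M} (hf : f 0 = 0) (i : ι) (x : α) :
    HasSum (fun j => f (Pi.single (M := fun _ => α) i x j)) (f x) := by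
  simpa only [Pi.single_eq_same] using
    hasSum_single (f := fun j => f (Pi.single (M := fun _ => α) i x j)) i
      fun j hj => by rw [Pi.single_eq_of_ne hj, hf]

section RelativelyBounded

variable {H K L : Type*} [NormedAddCommGroup H] [InnerProductSpace ℂ H]
  [NormedAddCommGroup K] [InnerProductSpace ℂ K] [NormedAddCommGroup L] [InnerProductSpace ℂ L]
  {S : H →ₗ.[ℂ] H} {A : H →ₗ.[ℂ] K} {B : H →ₗ.[ℂ] L}

theorem RelBoundedBy.mono_norm {a b : ℝ} (h : RelBoundedBy S A a b) (hA : S.domain ≤ A.domain)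
    (hBA : ∀ (x : H) (_ : x ∈ S.domain) (hxA : x ∈ A.domain) (hxB : x ∈ B.domain),
      ‖B ⟨x, hxB⟩‖ ≤ ‖A ⟨x, hxA⟩‖) : RelBoundedBy S B a b := fun x hxS hxB =>
  (pow_le_pow_left₀ (norm_nonneg _) (hBA x hxS (hA hxS) hxB) 2).trans (h x hxS (hA hxS))

theorem relBound_nonneg : 0 ≤ relBound S A := Real.sInf_nonneg fun _ hb => hb.1

theorem IsInfinitesimal.mono_norm (h : IsInfinitesimal S A) (hB : S.domain ≤ B.domain)
    (hBA : ∀ (x : H) (_ : x ∈ S.domain) (hxA : x ∈ A.domain) (hxB : x ∈ B.domain),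
      ‖B ⟨x, hxB⟩‖ ≤ ‖A ⟨x, hxA⟩‖) : IsInfinitesimal S B := by
  obtain ⟨⟨hA, a, b, ha, hb, hab⟩, hA0⟩ := h
  have hle : relBound S B ≤ relBound S A :=
    csInf_le_csInf ⟨0, fun _ hb => hb.1⟩ ⟨b, hb, a, ha, hab⟩
      fun _ ⟨hb, a, ha, hab⟩ => ⟨hb, a, ha, hab.mono_norm hA hBA⟩
  exact ⟨⟨hB, a, b, ha, hb, hab.mono_norm hA hBA⟩, (hle.trans_eq hA0).antisymm relBound_nonneg⟩

end RelativelyBounded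

section Parseval

variable {ι 𝕜 E : Type*} [RCLike 𝕜] [NormedAddCommGroup E] [InnerProductSpace 𝕜 E]

theorem hasSum_norm_inner_sq (b : HilbertBasis ι 𝕜 E) (x : E) :
    HasSum (fun i => ‖inner 𝕜 x (b i)‖ ^ 2) (‖x‖ ^ 2) := by
  have h := (b.hasSum_inner_mul_inner x x).mapL (RCLike.reCLM (K := 𝕜))
  simpa only [RCLike.reCLM_apply, inner_mul_symm_re_eq_norm, norm_mul, norm_inner_symm (b _) x,
    ← sq, inner_self_eq_norm_sq] using h

theorem tsum_enorm_inner_sq (b : HilbertBasis ι 𝕜 E) (x : E) :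
    ∑' i, ‖inner 𝕜 x (b i)‖ₑ ^ 2 = ‖x‖ₑ ^ 2 := by
  have h := hasSum_norm_inner_sq b x
  simp only [← ofReal_norm, ← ENNReal.ofReal_pow (norm_nonneg _)]
  rw [← ENNReal.ofReal_tsum_of_nonneg (fun _ => sq_nonneg _) h.summable, h.tsum_eq]

end Parseval

section HilbertTensor

variable {ι κ H K : Type*} [NormedAddCommGroup H] [InnerProductSpace ℂ H]
  [NormedAddCommGroup K] [InnerProductSpace ℂ K]

theorem HilbertTensor.eq_zero_of_inner_tensorRight {ψ : HilbertTensor H K}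
    (h : ∀ x y, ⟪ψ, tensorRight H y x⟫_ℂ = 0) : ψ = 0 := by
  refine UniformSpace.Completion.denseRange_coe.eq_zero_of_inner_left ℂ fun t : H ⊗[ℂ] K => ?_
  induction t with
  | zero => rw [UniformSpace.Completion.coe_zero, inner_zero_right]
  | tmul x y => exact h x y
  | add s t hs ht => rw [UniformSpace.Completion.coe_add, inner_add_right, hs, ht, add_zero]

theorem HilbertTensor.orthonormal_tensorRight {e : ι → H} {f : κ → K} (he : Orthonormal ℂ e)
    (hf : Orthonormal ℂ f) : Orthonormal ℂ fun p : ι × κ => tensorRight H (f p.2) (e p.1) :=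
  (he.tmul hf).comp_linearIsometry UniformSpace.Completion.toComplₗᵢ

theorem HilbertTensor.eq_zero_of_inner_hilbertBasis (b : HilbertBasis ι ℂ H)
    (c : HilbertBasis κ ℂ K) {ψ : HilbertTensor H K}
    (h : ∀ i k, ⟪ψ, tensorRight H (c k) (b i)⟫_ℂ = 0) : ψ = 0 := by
  let f : H →L[ℂ] K →L[ℂ] ℂ :=
    ContinuousLinearMap.compL ℂ K (H ⊗[ℂ] K) ℂ
      (innerSL ℂ ψ ∘L UniformSpace.Completion.toComplL) ∘L TensorProduct.mkL ℂ H K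
  have hf : f = 0 := by
    refine continuousLinearMap_ext_on₂
      (Submodule.dense_iff_topologicalClosure_eq_top.2 b.dense_span)
      (Submodule.dense_iff_topologicalClosure_eq_top.2 c.dense_span) ?_
    rintro _ ⟨i, rfl⟩ _ ⟨k, rfl⟩
    exact h i k
  exact eq_zero_of_inner_tensorRight fun x y => DFunLike.congr_fun (DFunLike.congr_fun hf x) y

/-- The Hilbert basis `bᵢ ⊗ cₖ` of the Hilbert tensor product given by Hilbert bases of the two
factors. -/
noncomputable def HilbertTensor.hilbertBasis (b : HilbertBasis ι ℂ H) (c : HilbertBasis κ ℂ K) :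
    HilbertBasis (ι × κ) ℂ (HilbertTensor H K) :=
  .mkOfOrthogonalEqBot (orthonormal_tensorRight b.orthonormal c.orthonormal) <|
    (Submodule.eq_bot_iff _).2 fun _ hψ => eq_zero_of_inner_hilbertBasis b c fun i k =>
      Submodule.inner_left_of_mem_orthogonal (Submodule.subset_span (Set.mem_range_self (i, k))) hψ

theorem HilbertTensor.hilbertBasis_apply (b : HilbertBasis ι ℂ H) (c : HilbertBasis κ ℂ K)
    (p : ι × κ) : hilbertBasis b c p = tensorRight H (c p.2) (b p.1) := by
  rw [hilbertBasis, HilbertBasis.coe_mkOfOrthogonalEqBot]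

theorem hasSum_norm_adjoint_tensorRight_sq [CompleteSpace H] [CompleteSpace K]
    (c : HilbertBasis κ ℂ K) (ψ : HilbertTensor H K) :
    HasSum (fun k => ‖(tensorRight H (c k)).adjoint ψ‖ ^ 2) (‖ψ‖ ^ 2) := by
  let b := stdBasis H
  have hψ := (Equiv.prodComm κ (stdBasisIndex H)).hasSum_iff.2
    (hasSum_norm_inner_sq (HilbertTensor.hilbertBasis b c) ψ)
  refine hψ.prod_fiberwise fun k => ?_
  simpa only [ContinuousLinearMap.adjoint_inner_left, HilbertTensor.hilbertBasis_apply,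
    Function.comp_apply, Equiv.prodComm_apply, Prod.fst_swap, Prod.snd_swap] using
    hasSum_norm_inner_sq b ((tensorRight H (c k)).adjoint ψ)

end HilbertTensor

section Traces

variable {H K : Type*} [NormedAddCommGroup H] [InnerProductSpace ℂ H] [CompleteSpace H]
  [NormedAddCommGroup K] [InnerProductSpace ℂ K] [CompleteSpace K]

theorem opTrace_rankOne (x y : H) : opTrace (rankOne ℂ x y) = ⟪y, x⟫_ℂ := by
  simp only [opTrace, inner_right_rankOne_apply]
  simpa only [mul_comm] using (stdBasis H).tsum_inner_mul_inner y x

theorem hasSum_partialTrace_rankOne (ψ ξ : HilbertTensor H K) :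
    HasSum (fun k => rankOne ℂ ((tensorRight H (stdBasis K k)).adjoint ψ)
      ((tensorRight H (stdBasis K k)).adjoint ξ)) (partialTrace (rankOne ℂ ψ ξ)) := by
  have hψ := (hasSum_norm_adjoint_tensorRight_sq (stdBasis K) ψ).summable
  have hξ := (hasSum_norm_adjoint_tensorRight_sq (stdBasis K) ξ).summable
  simp only [partialTrace, rankOne_comp, comp_rankOne]
  refine (Summable.of_norm_bounded (hψ.add hξ) fun k => ?_).hasSum
  rw [norm_rankOne]
  nlinarith [two_mul_le_add_sq ‖(tensorRight H (stdBasis K k)).adjoint ψ‖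
    ‖(tensorRight H (stdBasis K k)).adjoint ξ‖]

theorem opTrace_partialTrace_rankOne (ψ ξ : HilbertTensor H K) :
    opTrace (partialTrace (rankOne ℂ ψ ξ)) = ⟪ξ, ψ⟫_ℂ := by
  let b := stdBasis H
  let c := stdBasis K
  have htotal := (HilbertTensor.hilbertBasis b c).hasSum_inner_mul_inner ξ ψ
  refine (htotal.prod_fiberwise fun i => ?_).tsum_eq
  have hdiag := (hasSum_partialTrace_rankOne ψ ξ).mapL
    (innerSL ℂ (b i) ∘L ContinuousLinearMap.apply ℂ H (b i))
  simpa only [ContinuousLinearMap.comp_apply, ContinuousLinearMap.apply_apply,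
    innerSL_apply_apply, inner_right_rankOne_apply, ContinuousLinearMap.adjoint_inner_left,
    ContinuousLinearMap.adjoint_inner_right, HilbertTensor.hilbertBasis_apply, mul_comm] using hdiag

theorem rankOne_mem_traceClass {E : Type*} [NormedAddCommGroup E] [InnerProductSpace ℂ E]
    (x y : E) : rankOne ℂ x y ∈ traceClass E := by
  let p : ℕ → E × E := Pi.single 0 (x, y)
  exact ⟨fun n => (p n).1, fun n => (p n).2,
    (hasSum_apply_piSingle (f := fun q : E × E => ‖q.1‖ * ‖q.2‖) (by simp) 0 (x, y)).summable,
    hasSum_apply_piSingle (f := fun q : E × E => rankOne ℂ q.1 q.2) (by simp) 0 (x, y)⟩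

theorem IsSandwich.eq_rankOne {V : H →ₗ.[ℂ] K} {x : V.domain} {T : K →L[ℂ] K}
    (h : IsSandwich V (rankOne ℂ (x : H) (x : H)) T) : T = rankOne ℂ (V x) (V x) :=
  (h (Pi.single 0 x) (hasSum_apply_piSingle
    (f := fun y : V.domain => rankOne ℂ (y : H) (y : H)) (by simp) 0 x)).unique
    (hasSum_apply_piSingle (f := fun y => rankOne ℂ (V y) (V y)) (by simp) 0 x)

end Traces

section FiniteEnergy

variable {H : Type*} [NormedAddCommGroup H] [InnerProductSpace ℂ H] [CompleteSpace H]
  {G : H →ₗ.[ℂ] H} {x : H}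

theorem isState_rankOne_self (hx : ‖x‖ = 1) : IsState (rankOne ℂ x x) :=
  ⟨isPositive_rankOne_self x, rankOne_mem_traceClass x x, by
    rw [opTrace_rankOne, inner_self_eq_one_of_norm_eq_one hx]⟩

theorem sqrt_rankOne_self (hx : ‖x‖ = 1) : CFC.sqrt (rankOne ℂ x x) = rankOne ℂ x x :=
  CFC.sqrt_unique (isIdempotentElem_rankOne_self hx)
    ((ContinuousLinearMap.nonneg_iff_isPositive _).2 (isPositive_rankOne_self x))

theorem energyForm_smul (hG : IsPositiveSelfAdjoint G) (hxG : x ∈ (posSqrt G hG).domain) (c : ℂ) :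
    energyForm G hG (c • x) = ‖c‖ₑ ^ 2 * ‖posSqrt G hG ⟨x, hxG⟩‖ₑ ^ 2 := by
  have hsmul : posSqrt G hG ⟨c • x, Submodule.smul_mem _ c hxG⟩ = c • posSqrt G hG ⟨x, hxG⟩ :=
    (posSqrt G hG).map_smul c ⟨x, hxG⟩
  rw [energyForm, dif_pos (Submodule.smul_mem _ c hxG), hsmul, enorm_smul, mul_pow]

theorem energy_rankOne_self (hG : IsPositiveSelfAdjoint G) (hx : ‖x‖ = 1)
    (hxG : x ∈ (posSqrt G hG).domain) :
    energy G hG (rankOne ℂ x x) = ‖posSqrt G hG ⟨x, hxG⟩‖ₑ ^ 2 := by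
  simp only [energy, sqrt_rankOne_self hx, rankOne_apply, energyForm_smul hG hxG]
  rw [ENNReal.tsum_mul_right, tsum_enorm_inner_sq, ← ofReal_norm, hx, ENNReal.ofReal_one, one_pow,
    one_mul]

theorem rankOne_self_mem_finiteEnergyStates (hG : IsPositiveSelfAdjoint G) (hx : ‖x‖ = 1)
    (hxG : x ∈ (posSqrt G hG).domain) : rankOne ℂ x x ∈ finiteEnergyStates G hG :=
  ⟨isState_rankOne_self hx, (energy_rankOne_self hG hx hxG).trans_lt (by finiteness)⟩

end FiniteEnergy

section Representing

variable {HA HB HE HF : Type*}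
  [NormedAddCommGroup HA] [InnerProductSpace ℂ HA] [CompleteSpace HA]
  [NormedAddCommGroup HB] [InnerProductSpace ℂ HB] [CompleteSpace HB]
  [NormedAddCommGroup HE] [InnerProductSpace ℂ HE] [CompleteSpace HE]
  [NormedAddCommGroup HF] [InnerProductSpace ℂ HF] [CompleteSpace HF]
  {G : HA →ₗ.[ℂ] HA} {hG : IsPositiveSelfAdjoint G}
  {Φ : finiteEnergySpan G hG →ₗ[ℂ] traceClass HB}
  {V : HA →ₗ.[ℂ] HilbertTensor HB HE} {W : HA →ₗ.[ℂ] HilbertTensor HB HF}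

theorem IsRepresenting.opTrace_apply_rankOne_self (hV : IsRepresenting G hG Φ V) {x : HA}
    (hx : ‖x‖ = 1) (hxG : x ∈ (posSqrt G hG).domain) (hxV : x ∈ V.domain) :
    opTrace (Φ ⟨rankOne ℂ x x, Submodule.subset_span
      (rankOne_self_mem_finiteEnergyStates hG hx hxG)⟩ : HB →L[ℂ] HB) =
      (‖V ⟨x, hxV⟩‖ : ℂ) ^ 2 := by
  obtain ⟨T, hT, hΦ⟩ := hV.2 _ (rankOne_self_mem_finiteEnergyStates hG hx hxG)
  rw [hΦ, IsSandwich.eq_rankOne (x := ⟨x, hxV⟩) hT, opTrace_partialTrace_rankOne,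
    inner_self_eq_norm_sq_to_K]
  rfl

theorem IsRepresenting.norm_apply_eq (hV : IsRepresenting G hG Φ V) (hW : IsRepresenting G hG Φ W)
    {x : HA} (hxG : x ∈ (posSqrt G hG).domain) (hxV : x ∈ V.domain) (hxW : x ∈ W.domain) :
    ‖V ⟨x, hxV⟩‖ = ‖W ⟨x, hxW⟩‖ := by
  refine norm_apply_eq_of_forall_norm_eq_one (f := V.toFun ∘ₗ Submodule.inclusion hV.1.1)
    (g := W.toFun ∘ₗ Submodule.inclusion hW.1.1) (fun y hy => ?_) ⟨x, hxG⟩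
  have hsq := (hV.opTrace_apply_rankOne_self hy y.2 (hV.1.1 y.2)).symm.trans
    (hW.opTrace_apply_rankOne_self hy y.2 (hW.1.1 y.2))
  exact (pow_left_inj₀ (norm_nonneg _) (norm_nonneg _) two_ne_zero).1 (mod_cast hsq)

theorem corollary2_general (hV : IsRepresenting G hG Φ V) (hW : IsRepresenting G hG Φ W)
    (hWG : IsInfinitesimal (posSqrt G hG) W) : IsInfinitesimal (posSqrt G hG) V :=
  hWG.mono_norm hV.1.1 fun _ hxG hxW hxV => (hV.norm_apply_eq hW hxG hxV hxW).le

end Representing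

theorem corollary2 {HA : Type uA} {HB : Type uB}
    [NormedAddCommGroup HA] [InnerProductSpace ℂ HA] [CompleteSpace HA]
    [TopologicalSpace.SeparableSpace HA]
    [NormedAddCommGroup HB] [InnerProductSpace ℂ HB] [CompleteSpace HB]
    [TopologicalSpace.SeparableSpace HB]
    (G : HA →ₗ.[ℂ] HA) (hG : IsPositiveSelfAdjoint G)
    (Φ : finiteEnergySpan G hG →ₗ[ℂ] traceClass HB)
    (hΦ : Φ ∈ infinitesimalCone.{uE, uA, uB} HB G hG)
    (HE : Type uF) [NormedAddCommGroup HE] [InnerProductSpace ℂ HE] [CompleteSpace HE]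
    [TopologicalSpace.SeparableSpace HE]
    (V : HA →ₗ.[ℂ] HilbertTensor HB HE) (hV : IsRepresenting G hG Φ V) :
    IsInfinitesimal (posSqrt G hG) V := by
  obtain ⟨HF, _, _, _, _, W, hW, hWG⟩ := hΦ
  exact corollary2_general hV hW hWG
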